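/- A compact space means a compact Hausdorff space. A $k$-space is a topological space $X$ in which a subset $U$ is open if and only if $f^{-1}(U)$ is open for every continuous map $f:K\to X$ with $K$ compact; a space $X$ is weak Hausdorff if $f(K)$ is closed in $X$ for every such $f$. Let $\mathbf{Top}$ be the category of weak Hausdorff $k$-spaces and continuous maps. The Kelleyfication of a topology on $X$ is the final topology for all maps $K\to X$ with $K$ compact that are continuous for the given topology. A flow $X$ consists of a discrete space $X^0$, a weak Hausdorff $k$-space $\mathbb{P}X$, continuous maps $s,t:\mathbb{P}X\to X^0$ and a continuous associative map $*:\{(x,y)\in\mathbb{P}X\times\mathbb{P}X : t(x)=s(y)\}\to\mathbb{P}X$ (the domain being the fibre product formed in $\mathbf{Top}$, i.e. carrying the Kelleyfication of the subspace topology) such that $s(x*y)=s(x)$ and $t(x*y)=t(y)$. A morphism of flows $f:X\to Y$ consists of a set map $X^0\to Y^0$ and a continuous map $\mathbb{P}X\to\mathbb{P}Y$ that commute with $s$, $t$ and $*$; it is in particular a continuous map between the underlying spaces $X^0\sqcup\mathbb{P}X\to Y^0\sqcup\mathbb{P}Y$. Let $\mathbf{Flow}$ be the category of flows. For flows $X,Y$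 let $\mathbf{FLOW}(X,Y)$ be the set of morphisms of flows from $X$ to $Y$, equipped with the Kelleyfication of the compact-open topology (for maps between underlying spaces). **Theorem.** The mapping $(X,Y)\mapsto\mathbf{FLOW}(X,Y)$, together with composition of morphisms, is a functor from $\mathbf{Flow}\times\mathbf{Flow}$ to $\mathbf{Top}$, contravariant in $X$ and covariant in $Y$; in particular every $\mathbf{FLOW}(X,Y)$ is a weak Hausdorff $k$-space. Moreover: 1. For every flow $Y$ and every colimit $\varinjlim_i X_i$ in $\mathbf{Flow}$, the canonical map $\mathbf{FLOW}(\varinjlim_i X_i,Y)\to\varprojlim_i\mathbf{FLOW}(X_i,Y)$ is a homeomorphism, the limit being taken in $\mathbf{Top}$. 2. For every flow $X$ and every finite limit $\varprojlim_i Y_i$ in $\mathbf{Flow}$, the canonical map $\mathbf{FLOW}(X,\varprojlim_i Y_i)\to\varprojlim_i\mathbf{FLOW}(X,Y_i)$ is a homeomorphism, the limit being taken in $\mathbf{Top}$. -/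

import Mathlib

open CategoryTheory CategoryTheory.Limits Opposite

universe u v w

/-- A space is weak Hausdorff if every continuous image of a compact Hausdorff space in it is
closed. -/
class WeakHausdorffSpace (X : Type u) [TopologicalSpace X] : Prop where
  isClosed_range : ∀ (K : Type u) [TopologicalSpace K] [CompactSpace K] [T2Space K] (f : C(K, X)),
    IsClosed (Set.range f)

/-- The weak Hausdorff `k`-spaces. Here `CompactlyGeneratedSpace` is Mathlib's name for a `k`-space:
the topology is the final one for all continuous maps from compact Hausdorff spaces. -/
def isCGWH : ObjectProperty TopCat.{u} :=
  fun X => CompactlyGeneratedSpace X ∧ WeakHausdorffSpace X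

/-- The category of weak Hausdorff `k`-spaces and continuous maps. -/
abbrev CGWH : Type (u + 1) := (isCGWH.{u}).FullSubcategory

/-- The Kelleyfication of a topology: the final topology for all maps from compact Hausdorff spaces
that are continuous for the given topology. -/
abbrev kelleyfication {X : Type u} (t : TopologicalSpace X) : TopologicalSpace X :=
  @TopologicalSpace.compactlyGenerated.{u, u} X t

/-- Flows: a discrete space of states, a weak Hausdorff `k`-space of (non-constant) execution
paths, continuous source and target maps, and a continuous associative composition of composable
paths. The space of composable pairs is the fibre product formed in the category of weak Hausdorff
`k`-spaces, that is, the Kelleyfication of the subspace topology of the ordinary product. -/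
structure DirFlow : Type (u + 1) where
  State : Type u
  Path : Type u
  [topState : TopologicalSpace State]
  [discreteState : DiscreteTopology State]
  [topPath : TopologicalSpace Path]
  [cgPath : CompactlyGeneratedSpace Path]
  [whPath : WeakHausdorffSpace Path]
  src : C(Path, State)
  tgt : C(Path, State)
  comp : ∀ x y : Path, tgt x = src y → Path
  continuous_comp :
    @Continuous {p : Path × Path // tgt p.1 = src p.2} Path (kelleyfication inferInstance) topPath
      (fun p => comp p.1.1 p.1.2 p.2)
  src_comp : ∀ x y (h : tgt x = src y), src (comp x y h) = src x
  tgt_comp : ∀ x y (h : tgt x = src y), tgt (comp x y h) = tgt y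
  assoc : ∀ x y z (hxy : tgt x = src y) (hyz : tgt y = src z),
    comp (comp x y hxy) z ((tgt_comp x y hxy).trans hyz) =
      comp x (comp y z hyz) (hxy.trans (src_comp y z hyz).symm)

namespace DirFlow

attribute [instance] topState discreteState topPath cgPath whPath

/-- Morphisms of flows: a map on states and a continuous map on paths, compatible with source,
target and composition. -/
@[ext]
structure Hom (X Y : DirFlow.{u}) : Type u where
  onState : X.State → Y.State
  onPath : C(X.Path, Y.Path)
  map_src : ∀ x, onState (X.src x) = Y.src (onPath x)
  map_tgt : ∀ x, onState (X.tgt x) = Y.tgt (onPath x)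
  map_comp : ∀ x y (h : X.tgt x = X.src y),
    onPath (X.comp x y h) =
      Y.comp (onPath x) (onPath y) (by rw [← map_tgt, h, map_src])

/-- The category of flows. -/
instance : Category.{u} DirFlow.{u} where
  Hom := Hom
  id X :=
    { onState := id
      onPath := ContinuousMap.id X.Path
      map_src := fun _ => rfl
      map_tgt := fun _ => rfl
      map_comp := fun _ _ _ => rfl }
  comp {X Y Z} f g :=
    { onState := g.onState ∘ f.onState
      onPath := g.onPath.comp f.onPath
      map_src := fun x => by simp [f.map_src, g.map_src]
      map_tgt := fun x => by simp [f.map_tgt, g.map_tgt]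
      map_comp := fun x y h => by simp [f.map_comp, g.map_comp] }

/-- The underlying space of a flow: the disjoint sum of its states and of its paths. -/
abbrev Total (X : DirFlow.{u}) : Type u := X.State ⊕ X.Path

/-- The continuous map between underlying spaces given by a morphism of flows. -/
def Hom.total {X Y : DirFlow.{u}} (f : Hom X Y) : C(X.Total, Y.Total) where
  toFun := Sum.map f.onState f.onPath
  continuous_toFun := continuous_of_discreteTopology.sumMap f.onPath.continuous

/-- The space of morphisms of flows from `X` to `Y`. -/
def FLOW (X Y : DirFlow.{u}) : Type u := X ⟶ Y

/-- The compact-open topology on the set of morphisms of flows, these being regarded as continuous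
maps between underlying spaces. -/
abbrev compactOpen (X Y : DirFlow.{u}) : TopologicalSpace (FLOW X Y) :=
  TopologicalSpace.induced (Hom.total : FLOW X Y → C(X.Total, Y.Total)) ContinuousMap.compactOpen

/-- `FLOW X Y` carries the Kelleyfication of the compact-open topology. -/
instance (X Y : DirFlow.{u}) : TopologicalSpace (FLOW X Y) := kelleyfication (compactOpen X Y)

/-- The map `φ ↦ g ∘ φ ∘ f` from `FLOW X Y` to `FLOW X' Y'`. -/
def FLOW.map {X X' Y Y' : DirFlow.{u}} (f : X' ⟶ X) (g : Y ⟶ Y') : FLOW X Y → FLOW X' Y' :=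
  fun φ => f ≫ (φ : X ⟶ Y) ≫ g

/-- All spaces `FLOW X Y` are weak Hausdorff `k`-spaces. -/
def FLOWIsCGWH : Prop := ∀ X Y : DirFlow.{u}, isCGWH (TopCat.of (FLOW X Y))

/-- All maps `φ ↦ g ∘ φ ∘ f` are continuous. -/
def FLOWMapContinuous : Prop :=
  ∀ ⦃X X' Y Y' : DirFlow.{u}⦄ (f : X' ⟶ X) (g : Y ⟶ Y'), Continuous (FLOW.map f g)

/-- The functor `(X, Y) ↦ FLOW X Y`, contravariant in `X` and covariant in `Y`, with values in weak
Hausdorff `k`-spaces, once its values on objects and on morphisms are known to be objects and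
morphisms of that category. -/
def flowFunctor (hobj : FLOWIsCGWH.{u}) (hmap : FLOWMapContinuous.{u}) :
    DirFlow.{u}ᵒᵖ × DirFlow.{u} ⥤ CGWH.{u} where
  obj P := ⟨TopCat.of (FLOW P.1.unop P.2), hobj P.1.unop P.2⟩
  map a := ObjectProperty.homMk (TopCat.ofHom ⟨FLOW.map a.1.unop a.2, hmap a.1.unop a.2⟩)
  map_id _ := rfl
  map_comp _ _ := rfl

end DirFlow

/-! All topologies involved are tested on compact Hausdorff spaces `K`, and a continuous map `K →
FLOW X Y` is a jointly continuous family of morphisms (`FLOW.continuous_iff`). Evaluations at states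
and paths separate morphisms, whence weak Hausdorffness (`WeakHausdorffSpace.of_separating`).

On underlying sets, both universal properties are those of the given (co)limit in flows; only
continuity is at stake. For colimits, a continuous family over `K` is the same as one morphism `X ⟶
cotensor K Y`, so families on the pieces glue without any description of colimits of flows. For
limits, states and paths are probed by morphisms from the flows `glob M s t`. Finiteness keeps the
limit of the discrete state spaces discrete. -/

/-! ### Weak Hausdorff spaces and `k`-spaces. -/

section WeakHausdorff

instance (priority := 100) T2Space.weakHausdorffSpace {X : Type u} [TopologicalSpace X]
    [T2Space X] : WeakHausdorffSpace X where
  isClosed_range _ _ _ _ f := (isCompact_range f.continuous).isClosed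

variable {K L X Y Z : Type u} [TopologicalSpace K] [CompactSpace K] [T2Space K]
  [TopologicalSpace L] [CompactSpace L] [T2Space L]
  [TopologicalSpace X] [TopologicalSpace Y] [TopologicalSpace Z]

theorem WeakHausdorffSpace.isClosedMap [WeakHausdorffSpace Y] {f : K → Y} (hf : Continuous f) :
    IsClosedMap f := by
  intro s hs
  have : CompactSpace s := isCompact_iff_compactSpace.1 hs.isCompact
  simpa [Set.range_comp] using
    WeakHausdorffSpace.isClosed_range s ⟨f ∘ ((↑) : s → K), hf.comp continuous_subtype_val⟩

theorem WeakHausdorffSpace.isClosed_singleton [WeakHausdorffSpace Y] (y : Y) :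
    IsClosed ({y} : Set Y) := by
  simpa using WeakHausdorffSpace.isClosed_range PUnit.{u + 1} ⟨fun _ => y, continuous_const⟩

/-- The fibre product of two compact Hausdorff spaces over a weak Hausdorff space is closed in
their product. -/
theorem WeakHausdorffSpace.isClosed_setOf_eq [WeakHausdorffSpace Y] {f : K → Y} {g : L → Y}
    (hf : Continuous f) (hg : Continuous g) : IsClosed {p : K × L | f p.1 = g p.2} := by
  have hh : Continuous (Sum.elim f g) := hf.sumElim hg
  rw [← isOpen_compl_iff, isOpen_iff_forall_mem_open]
  rintro ⟨k, l⟩ hkl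
  have hkl : f k ≠ g l := hkl
  -- In `K ⊕ L` both fibres are closed subsets of a single normal space.
  obtain ⟨U, V, hU, hV, hkU, hlV, hUV⟩ := normal_separation
    ((WeakHausdorffSpace.isClosed_singleton (f k)).preimage hh)
    ((WeakHausdorffSpace.isClosed_singleton (g l)).preimage hh)
    (Disjoint.preimage _ (by simpa using hkl))
  have hU' := (WeakHausdorffSpace.isClosedMap hh _ hU.isClosed_compl).isOpen_compl
  have hV' := (WeakHausdorffSpace.isClosedMap hh _ hV.isClosed_compl).isOpen_compl
  -- The box of pairs `(a, b)` such that the whole fibre over `f a` lies in `U` and the whole fibre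
  -- over `g b` lies in `V`.
  refine ⟨(f ⁻¹' (Sum.elim f g '' Uᶜ)ᶜ) ×ˢ (g ⁻¹' (Sum.elim f g '' Vᶜ)ᶜ), ?_,
    (hU'.preimage hf).prod (hV'.preimage hg), ?_, ?_⟩
  · rintro ⟨a, b⟩ ⟨ha, hb⟩ (hab : f a = g b)
    have haU : Sum.inl a ∈ U := by
      by_contra h
      exact ha ⟨_, h, rfl⟩
    have haV : Sum.inl a ∈ V := by
      by_contra h
      exact hb ⟨_, h, hab⟩
    exact Set.disjoint_left.1 hUV haU haV
  · rintro ⟨m, hm, e⟩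
    exact hm (hkU e)
  · rintro ⟨m, hm, e⟩
    exact hm (hlV e)

/-- A `k`-space whose points are separated by continuous maps to weak Hausdorff spaces is weak
Hausdorff. -/
theorem WeakHausdorffSpace.of_separating [CompactlyGeneratedSpace Z]
    (h : ∀ z z' : Z, z ≠ z' → ∃ (W : Type u) (_ : TopologicalSpace W) (_ : WeakHausdorffSpace W)
      (e : Z → W), Continuous e ∧ e z ≠ e z') : WeakHausdorffSpace Z where
  isClosed_range K _ _ _ f := by
    refine CompactlyGeneratedSpace.isClosed' fun L _ _ _ g hg => ?_
    have hcl : IsClosed {p : K × L | f p.1 = g p.2} := by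
      have : {p : K × L | f p.1 = g p.2} = ⋂ (W : Type u) (_ : TopologicalSpace W)
          (_ : WeakHausdorffSpace W) (e : Z → W) (_ : Continuous e),
            {p : K × L | e (f p.1) = e (g p.2)} := by
        ext p
        simp only [Set.mem_ofPred_eq, Set.mem_iInter]
        refine ⟨fun hp _ _ _ e _ => congrArg e hp, fun hp => ?_⟩
        by_contra hne
        obtain ⟨W, _, _, e, he, hne'⟩ := h _ _ hne
        exact hne' (hp W _ ‹_› e he)
      rw [this]
      exact isClosed_iInter fun W => isClosed_iInter fun _ => isClosed_iInter fun _ =>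
        isClosed_iInter fun e => isClosed_iInter fun he =>
          WeakHausdorffSpace.isClosed_setOf_eq (he.comp f.continuous) (he.comp hg)
    -- The preimage is a projection of the fibre product along the compact factor `K`, and such a
    -- projection is closed.
    have : g ⁻¹' Set.range f = Prod.snd '' {p : K × L | f p.1 = g p.2} := by
      ext l
      simp
    rw [this]
    exact isClosedMap_snd_of_compactSpace _ hcl

/-- A map defined on the product of a compact Hausdorff space and a `k`-space is continuous if it
is so after pulling back along all maps from compact Hausdorff spaces to the second factor. -/
theorem continuous_prod_of_compactlyGeneratedSpace [CompactlyGeneratedSpace X] {f : K × X → Y}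
    (h : ∀ (L : Type u) [TopologicalSpace L] [CompactSpace L] [T2Space L] (g : L → X),
      Continuous g → Continuous fun p : K × L => f (p.1, g p.2)) : Continuous f := by
  have hx (x : X) : Continuous fun k => f (k, x) :=
    (h PUnit.{u + 1} (fun _ => x) continuous_const).comp
      (continuous_id.prodMk (continuous_const (y := PUnit.unit)))
  -- Currying turns the claim into continuity of a map out of the `k`-space `X`; uncurrying is
  -- allowed since `K` is locally compact.
  let F : X → C(K, Y) := fun x => ⟨fun k => f (k, x), hx x⟩
  have hF : Continuous F := by
    refine continuous_from_compactlyGeneratedSpace F fun L _ _ _ g hg => ?_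
    exact ContinuousMap.continuous_of_continuous_uncurry _ ((h L g hg).comp continuous_swap)
  exact (ContinuousMap.continuous_uncurry_of_continuous ⟨F, hF⟩).comp continuous_swap

end WeakHausdorff

/-! ### Kelleyfication. -/

section Kelleyfication

variable {K X Y : Type u} [TopologicalSpace K] [CompactSpace K] [T2Space K]

theorem kelleyfication_le (t : TopologicalSpace X) : kelleyfication t ≤ t :=
  continuous_id_iff_le.1 (continuous_from_compactlyGenerated id fun _ g => g.continuous)

theorem Continuous.kelleyfication_rng {t : TopologicalSpace X} {f : K → X} (hf : Continuous f) :
    @Continuous _ _ _ (kelleyfication t) f := by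
  have h := continuous_sigmaMk (σ := fun i : (S : CompHaus.{u}) × C(S, X) => i.fst)
    (i := ⟨CompHaus.of K, ⟨f, hf⟩⟩)
  exact @Continuous.comp _ _ _ _ _ (kelleyfication t) _
    (fun x : Σ (i : (S : CompHaus.{u}) × C(S, X)), i.fst => x.1.2 x.2) continuous_coinduced_rng h

/-- Kelleyfication is invisible to maps from compact Hausdorff spaces, since these maps are the ones
that define it. -/
theorem continuous_kelleyfication_rng_iff {t : TopologicalSpace X} {f : K → X} :
    @Continuous _ _ _ (kelleyfication t) f ↔ Continuous f :=
  ⟨fun h => continuous_le_rng (kelleyfication_le t) h, fun h => h.kelleyfication_rng⟩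

theorem continuous_kelleyfication_dom {t : TopologicalSpace X} [TopologicalSpace Y] {f : X → Y}
    (h : ∀ (L : Type u) [TopologicalSpace L] [CompactSpace L] [T2Space L] (g : L → X),
      Continuous g → Continuous (f ∘ g)) : @Continuous _ _ (kelleyfication t) _ f :=
  continuous_from_compactlyGenerated f fun S g => h S g g.continuous

theorem compactlyGeneratedSpace_kelleyfication (t : TopologicalSpace X) :
    @CompactlyGeneratedSpace X (kelleyfication t) :=
  @compactlyGeneratedSpace_of_continuous_maps X (kelleyfication t) fun _ h =>
    continuous_kelleyfication_dom fun L _ _ _ g hg => h L g hg.kelleyfication_rng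

end Kelleyfication

/-- The diagonal of `S` is open, so by compactness of `K` the condition that `(g, h)` lands in it is
open in `h`. This makes the states of a cotensor discrete. -/
instance ContinuousMap.discreteTopology {K S : Type*} [TopologicalSpace K] [CompactSpace K]
    [T2Space K] [TopologicalSpace S] [DiscreteTopology S] : DiscreteTopology C(K, S) := by
  refine discreteTopology_iff_isOpen_singleton.2 fun g => ?_
  have : IsOpen ((fun h : C(K, S) => g.prodMk h) ⁻¹' {F | Set.range F ⊆ Set.diagonal S}) :=
    (ContinuousMap.isOpen_setOfPred_range_subset (isOpen_discrete _)).preimage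
      (ContinuousMap.continuous_of_continuous_uncurry _
        ((g.continuous.comp continuous_snd).prodMk continuous_eval))
  convert this
  ext h
  simp [Set.range_subset_iff, ContinuousMap.ext_iff, eq_comm]

namespace DirFlow

/-! ### The spaces `FLOW X Y` and their functoriality. -/

section MappingSpace

variable {K : Type u} [TopologicalSpace K] [CompactSpace K] [T2Space K] {X Y : DirFlow.{u}}

/-- The defining property of `FLOW X Y`: a map to it from a compact Hausdorff space `K` is
continuous if and only if it is jointly continuous on states and on paths. -/
theorem FLOW.continuous_iff {φ : K → FLOW X Y} :
    Continuous φ ↔ (∀ x, Continuous fun k => Hom.onState (φ k) x) ∧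
      Continuous fun p : K × X.Path => Hom.onPath (φ p.1) p.2 := by
  refine (continuous_kelleyfication_rng_iff (t := compactOpen X Y)).trans
    (continuous_induced_rng.trans ⟨?_, ?_⟩)
  · intro h
    refine ⟨fun x => ?_, ?_⟩
    · exact Topology.IsEmbedding.inl.continuous_iff.2
        ((continuous_eval_const (F := C(X.Total, Y.Total)) (Sum.inl x)).comp h)
    · refine continuous_prod_of_compactlyGeneratedSpace fun L _ _ _ g hg => ?_
      let i : C(L, X.Total) := ⟨fun l => Sum.inr (g l), continuous_inr.comp hg⟩
      exact Topology.IsEmbedding.inr.continuous_iff.2 (ContinuousMap.continuous_uncurry_of_continuous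
        ⟨_, (ContinuousMap.continuous_precomp (Z := Y.Total) i).comp h⟩)
  · rintro ⟨hs, hp⟩
    refine ContinuousMap.continuous_of_continuous_uncurry _ ?_
    rw [← Homeomorph.prodSumDistrib.symm.comp_continuous_iff', continuous_sum_dom]
    exact ⟨continuous_inl.comp (continuous_prod_of_discrete_right.2 hs), continuous_inr.comp hp⟩

instance (X Y : DirFlow.{u}) : CompactlyGeneratedSpace (FLOW X Y) :=
  compactlyGeneratedSpace_kelleyfication _

theorem FLOW.continuous_onState (x : X.State) :
    Continuous fun φ : FLOW X Y => Hom.onState φ x :=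
  continuous_from_compactlyGeneratedSpace _ fun _ _ _ _ _ hg => (FLOW.continuous_iff.1 hg).1 x

theorem FLOW.continuous_onPath (x : X.Path) :
    Continuous fun φ : FLOW X Y => Hom.onPath φ x :=
  continuous_from_compactlyGeneratedSpace _ fun _ _ _ _ _ hg =>
    (FLOW.continuous_iff.1 hg).2.comp (continuous_id.prodMk continuous_const)

instance (X Y : DirFlow.{u}) : WeakHausdorffSpace (FLOW X Y) :=
  WeakHausdorffSpace.of_separating fun φ ψ h => by
    by_contra! hc
    refine h (Hom.ext ?_ ?_)
    · funext x
      exact hc Y.State _ inferInstance _ (FLOW.continuous_onState x)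
    · ext x
      exact hc Y.Path _ inferInstance _ (FLOW.continuous_onPath x)

theorem FLOWIsCGWH.of_all : FLOWIsCGWH.{u} := fun X Y =>
  ⟨inferInstanceAs (CompactlyGeneratedSpace (FLOW X Y)),
    inferInstanceAs (WeakHausdorffSpace (FLOW X Y))⟩

theorem FLOWMapContinuous.of_all : FLOWMapContinuous.{u} := fun X X' Y Y' f g =>
  continuous_from_compactlyGeneratedSpace _ fun K _ _ _ φ hφ => by
    obtain ⟨hs, hp⟩ := FLOW.continuous_iff.1 hφ
    refine FLOW.continuous_iff.2 ⟨fun x => ?_, ?_⟩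
    · exact (continuous_of_discreteTopology (f := Hom.onState g)).comp (hs (Hom.onState f x))
    · exact (Hom.onPath g).continuous.comp (hp.comp (continuous_id.prodMap (Hom.onPath f).continuous))

end MappingSpace

/-! ### Cotensors by compact Hausdorff spaces. -/

section Cotensor

variable (K : Type u) [TopologicalSpace K] (X Y : DirFlow.{u})

/-- The continuous maps from `K` to the space of paths of `Y`. -/
def PathFamily : Type u := C(K, Y.Path)

variable {K Y} in
/-- A family of paths as a continuous map. -/
def PathFamily.toMap (p : PathFamily K Y) : C(K, Y.Path) := p

/-- The separate type keeps this topology from competing with the compact-open one on `C(K,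
Y.Path)`. -/
instance : TopologicalSpace (PathFamily K Y) :=
  kelleyfication (inferInstanceAs (TopologicalSpace C(K, Y.Path)))

instance : CompactlyGeneratedSpace (PathFamily K Y) :=
  compactlyGeneratedSpace_kelleyfication _

variable {K Y} in
theorem PathFamily.continuous_toMap :
    Continuous (PathFamily.toMap : PathFamily K Y → C(K, Y.Path)) :=
  continuous_id_iff_le.2 (kelleyfication_le ContinuousMap.compactOpen)

variable [CompactSpace K] [T2Space K]

variable {K Y} in
theorem PathFamily.continuous_iff {L : Type u} [TopologicalSpace L] [CompactSpace L] [T2Space L]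
    {φ : L → PathFamily K Y} :
    Continuous φ ↔ Continuous fun p : L × K => (φ p.1).toMap p.2 := by
  refine (continuous_kelleyfication_rng_iff (X := C(K, Y.Path))).trans ⟨fun h => ?_, fun h => ?_⟩
  · exact ContinuousMap.continuous_uncurry_of_continuous ⟨_, h⟩
  · exact ContinuousMap.continuous_of_continuous_uncurry _ h

instance : WeakHausdorffSpace (PathFamily K Y) :=
  WeakHausdorffSpace.of_separating fun φ ψ h => by
    by_contra! hc
    refine h (ContinuousMap.ext fun k => ?_)
    exact hc Y.Path _ inferInstance _
      ((continuous_eval_const k).comp PathFamily.continuous_toMap)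

variable {K Y} in
theorem continuous_comp_of_continuous {L : Type u} [TopologicalSpace L] [CompactSpace L]
    [T2Space L] {f g : L → Y.Path} (hf : Continuous f) (hg : Continuous g)
    (h : ∀ l, Y.tgt (f l) = Y.src (g l)) : Continuous fun l => Y.comp (f l) (g l) (h l) :=
  have hfg : Continuous fun l =>
      (⟨(f l, g l), h l⟩ : {p : Y.Path × Y.Path // Y.tgt p.1 = Y.src p.2}) :=
    (hf.prodMk hg).subtype_mk h
  @Continuous.comp _ _ _ _ (kelleyfication inferInstance) _ _ _ Y.continuous_comp
    hfg.kelleyfication_rng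

/-- The cotensor of a flow by a compact Hausdorff space `K`: its states and its paths are the
continuous families, parametrised by `K`, of states and of paths. -/
def cotensor : DirFlow.{u} where
  State := C(K, Y.State)
  Path := PathFamily K Y
  src := ⟨fun p => Y.src.comp p.toMap,
    (ContinuousMap.continuous_postcomp Y.src).comp PathFamily.continuous_toMap⟩
  tgt := ⟨fun p => Y.tgt.comp p.toMap,
    (ContinuousMap.continuous_postcomp Y.tgt).comp PathFamily.continuous_toMap⟩
  comp p q h := ⟨fun k => Y.comp (p.toMap k) (q.toMap k) (DFunLike.congr_fun h k),
    continuous_comp_of_continuous p.toMap.continuous q.toMap.continuous _⟩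
  continuous_comp := continuous_kelleyfication_dom fun L _ _ _ g hg => by
    refine PathFamily.continuous_iff.2 ?_
    have h1 := PathFamily.continuous_iff.1 (continuous_fst.comp (continuous_subtype_val.comp hg))
    have h2 := PathFamily.continuous_iff.1 (continuous_snd.comp (continuous_subtype_val.comp hg))
    exact continuous_comp_of_continuous h1 h2 fun p : L × K => DFunLike.congr_fun (g p.1).2 p.2
  src_comp p q h := ContinuousMap.ext fun k => Y.src_comp _ _ _
  tgt_comp p q h := ContinuousMap.ext fun k => Y.tgt_comp _ _ _
  assoc p q r h h' := ContinuousMap.ext fun k => Y.assoc _ _ _ _ _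

variable {K X Y}

/-- The morphism to the cotensor adjoint to a continuous family of morphisms. -/
def toCotensor (φ : K → FLOW X Y) (hφ : Continuous φ) : X ⟶ cotensor K Y where
  onState x := ⟨fun k => Hom.onState (φ k) x, (FLOW.continuous_iff.1 hφ).1 x⟩
  onPath := ⟨fun x => (⟨fun k => Hom.onPath (φ k) x, (FLOW.continuous_iff.1 hφ).2.comp
      (continuous_id.prodMk continuous_const)⟩ : C(K, Y.Path)),
    continuous_from_compactlyGeneratedSpace _ fun _ _ _ _ _ hg =>
      PathFamily.continuous_iff.2 ((FLOW.continuous_iff.1 hφ).2.comp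
        (continuous_snd.prodMk (hg.comp continuous_fst)))⟩
  map_src x := ContinuousMap.ext fun k => Hom.map_src (φ k) x
  map_tgt x := ContinuousMap.ext fun k => Hom.map_tgt (φ k) x
  map_comp x y h := ContinuousMap.ext fun k => Hom.map_comp (φ k) x y h

/-- Evaluation of the cotensor at a point of `K`. -/
def cotensorEval (Y : DirFlow.{u}) (k : K) : cotensor K Y ⟶ Y where
  onState s := s.toFun k
  onPath := ⟨fun p => PathFamily.toMap p k,
    (continuous_eval_const k).comp PathFamily.continuous_toMap⟩
  map_src _ := rfl
  map_tgt _ := rfl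
  map_comp _ _ _ := rfl

theorem cotensor_hom_ext {f g : X ⟶ cotensor K Y}
    (h : ∀ k, f ≫ cotensorEval Y k = g ≫ cotensorEval Y k) : f = g := by
  refine Hom.ext ?_ ?_
  · funext x
    exact ContinuousMap.ext fun k => congrFun (congrArg Hom.onState (h k)) x
  · refine ContinuousMap.ext fun x => ContinuousMap.ext fun k => ?_
    exact DFunLike.congr_fun (congrArg Hom.onPath (h k)) x

/-- The converse of `toCotensor`: a morphism to the cotensor yields a continuous family of
morphisms. -/
theorem continuous_comp_cotensorEval (f : X ⟶ cotensor K Y) :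
    @Continuous K (FLOW X Y) _ _ fun k => f ≫ cotensorEval Y k := by
  refine FLOW.continuous_iff.2 ⟨fun x => (Hom.onState f x).continuous, ?_⟩
  refine continuous_prod_of_compactlyGeneratedSpace fun L _ _ _ g hg => ?_
  exact (PathFamily.continuous_iff.1 ((Hom.onPath f).continuous.comp hg)).comp continuous_swap

end Cotensor

/-! ### Continuity of families out of a colimit. -/

section Colimits

variable {J : Type w} [Category.{v} J] {D : J ⥤ DirFlow.{u}} {c : Cocone D} (hc : IsColimit c)
include hc

/-- A family of morphisms out of a colimit is continuous if its restrictions to the objects of the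
diagram are. -/
theorem continuous_of_isColimit {Z : Type u} [TopologicalSpace Z] [CompactlyGeneratedSpace Z]
    {Y : DirFlow.{u}} (φ : Z → FLOW c.pt Y)
    (h : ∀ j, Continuous fun z => FLOW.map (c.ι.app j) (𝟙 Y) (φ z)) :
    Continuous φ := by
  refine continuous_from_compactlyGeneratedSpace _ fun K _ _ _ g hg => ?_
  let s : Cocone D :=
    { pt := cotensor K Y
      ι :=
        { app j := toCotensor _ ((h j).comp hg)
          naturality i j f := cotensor_hom_ext fun k => by
            exact congrArg (fun a => FLOW.map a (𝟙 Y) (φ (g k))) (c.w f) } }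
  -- The glued morphism, evaluated at `k`, restricts to every `D.obj j` as `φ (g k)` does.
  have hφ : φ ∘ g = fun k => (hc.desc s ≫ cotensorEval Y k : FLOW c.pt Y) := by
    funext k
    refine hc.hom_ext fun j => ?_
    rw [← Category.assoc, hc.fac]
    rfl
  rw [hφ]
  exact continuous_comp_cotensorEval _

end Colimits

end DirFlow

namespace DirFlow

/-! ### Probing flows. -/

section Glob

variable (M : Type u) [TopologicalSpace M] [CompactlyGeneratedSpace M] [WeakHausdorffSpace M]
  {S T : Type u} [TopologicalSpace S] [DiscreteTopology S] [TopologicalSpace T]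
  [DiscreteTopology T]

/-- The flow without composable paths whose space of paths is `M`, with sources in `S` and targets
in `T`. -/
def glob (s : C(M, S)) (t : C(M, T)) : DirFlow.{u} where
  State := S ⊕ T
  Path := M
  src := ⟨fun m => Sum.inl (s m), continuous_inl.comp s.continuous⟩
  tgt := ⟨fun m => Sum.inr (t m), continuous_inr.comp t.continuous⟩
  comp _ _ h := (Sum.inr_ne_inl h).elim
  continuous_comp := continuous_kelleyfication_dom fun L _ _ _ g _ =>
    have : IsEmpty L := ⟨fun l => Sum.inr_ne_inl (g l).2⟩
    continuous_of_discreteTopology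
  src_comp _ _ h := (Sum.inr_ne_inl h).elim
  tgt_comp _ _ h := (Sum.inr_ne_inl h).elim
  assoc _ _ _ h := (Sum.inr_ne_inl h).elim

variable {M}

/-- Morphisms out of `glob M s t`. -/
def globDesc {s : C(M, S)} {t : C(M, T)} {Y : DirFlow.{u}} (f : S → Y.State) (g : T → Y.State)
    (p : C(M, Y.Path)) (hf : ∀ m, f (s m) = Y.src (p m)) (hg : ∀ m, g (t m) = Y.tgt (p m)) :
    glob M s t ⟶ Y where
  onState := Sum.elim f g
  onPath := p
  map_src := hf
  map_tgt := hg
  map_comp _ _ h := (Sum.inr_ne_inl h).elim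

end Glob

/-! ### Continuity of families into a finite limit. -/

section Limits

variable {J : Type w} [Category.{v} J] {D : J ⥤ DirFlow.{u}} {c : Cone D} (hc : IsLimit c)
include hc

/-- A state is a morphism from the flow with one state and no paths. -/
theorem onState_injective_of_isLimit {x y : c.pt.State}
    (h : ∀ j, Hom.onState (c.π.app j) x = Hom.onState (c.π.app j) y) : x = y := by
  let e (x : c.pt.State) : glob PEmpty.{u + 1} (S := PUnit.{u + 1}) (T := PEmpty.{u + 1})
      ⟨PEmpty.elim, continuous_of_discreteTopology⟩ (ContinuousMap.id _) ⟶ c.pt :=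
    globDesc (fun _ => x) PEmpty.elim ⟨PEmpty.elim, continuous_of_discreteTopology⟩
      (fun m => m.elim) (fun m => m.elim)
  have : e x = e y := hc.hom_ext fun j => by
    refine Hom.ext ?_ (ContinuousMap.ext fun m : PEmpty => m.elim)
    funext a
    rcases a with a | a
    · exact h j
    · exact a.elim
  exact congrFun (congrArg Hom.onState this) (Sum.inl PUnit.unit)

/-- A path is a morphism from the flow with a single arrow; its endpoints are settled by the case of
states. -/
theorem onPath_injective_of_isLimit {x y : c.pt.Path}
    (h : ∀ j, Hom.onPath (c.π.app j) x = Hom.onPath (c.π.app j) y) : x = y := by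
  have hs : c.pt.src x = c.pt.src y := onState_injective_of_isLimit hc fun j =>
    (Hom.map_src (c.π.app j) x).trans
      ((congrArg (D.obj j).src (h j)).trans (Hom.map_src (c.π.app j) y).symm)
  have ht : c.pt.tgt x = c.pt.tgt y := onState_injective_of_isLimit hc fun j =>
    (Hom.map_tgt (c.π.app j) x).trans
      ((congrArg (D.obj j).tgt (h j)).trans (Hom.map_tgt (c.π.app j) y).symm)
  -- Both morphisms are given the endpoints of `x`, so that they agree on states by `rfl`.
  let e (z : c.pt.Path) (hs : c.pt.src x = c.pt.src z) (ht : c.pt.tgt x = c.pt.tgt z) :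
      glob PUnit.{u + 1} (ContinuousMap.id _) (ContinuousMap.id _) ⟶ c.pt :=
    globDesc (fun _ => c.pt.src x) (fun _ => c.pt.tgt x) (ContinuousMap.const _ z)
      (fun _ => hs) (fun _ => ht)
  have : e x rfl rfl = e y hs ht := hc.hom_ext fun j =>
    Hom.ext rfl (ContinuousMap.ext fun _ => h j)
  exact DFunLike.congr_fun (congrArg Hom.onPath this) PUnit.unit

/-- The space of states of a finite limit of flows is the limit of the (discrete) spaces of
states. -/
theorem continuous_state_of_isLimit [Finite J] {Z : Type*} [TopologicalSpace Z]
    {f : Z → c.pt.State} (h : ∀ j, Continuous fun z => Hom.onState (c.π.app j) (f z)) :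
    Continuous f := by
  refine continuous_discrete_rng.2 fun x => ?_
  have : f ⁻¹' {x} = ⋂ j, (fun z => Hom.onState (c.π.app j) (f z)) ⁻¹'
      {Hom.onState (c.π.app j) x} := by
    ext z
    simp only [Set.mem_preimage, Set.mem_singleton_iff, Set.mem_iInter]
    exact ⟨fun e j => by rw [e], onState_injective_of_isLimit hc⟩
  rw [this]
  -- Finiteness of `J` enters here.
  exact isOpen_iInter_of_finite fun j => (isOpen_discrete _).preimage (h j)

/-- The space of paths of a finite limit of flows is the limit of the spaces of paths. -/
theorem continuous_path_of_isLimit [Finite J] {M : Type u} [TopologicalSpace M] [CompactSpace M]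
    [T2Space M] {f : M → c.pt.Path} (h : ∀ j, Continuous fun m => Hom.onPath (c.π.app j) (f m)) :
    Continuous f := by
  have hs : Continuous fun m => c.pt.src (f m) := continuous_state_of_isLimit hc fun j =>
    ((D.obj j).src.continuous.comp (h j)).congr fun m => (Hom.map_src (c.π.app j) (f m)).symm
  have ht : Continuous fun m => c.pt.tgt (f m) := continuous_state_of_isLimit hc fun j =>
    ((D.obj j).tgt.continuous.comp (h j)).congr fun m => (Hom.map_tgt (c.π.app j) (f m)).symm
  -- The legs bundle `f` into a cone over `D` with apex a flow whose path space is `M`; its lift is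
  -- continuous on paths and must agree with `f`. Continuity of the endpoints is needed to form this
  -- apex.
  let s : Cone D :=
    { pt := glob M ⟨_, hs⟩ ⟨_, ht⟩
      π :=
        { app j := globDesc (Hom.onState (c.π.app j)) (Hom.onState (c.π.app j)) ⟨_, h j⟩
            (fun m => Hom.map_src _ _) (fun m => Hom.map_tgt _ _)
          naturality i j a := by
            have hw := c.w a
            refine Hom.ext ?_ (ContinuousMap.ext fun m => ?_)
            · funext x
              rcases x with x | x
              · exact (congrFun (congrArg Hom.onState hw) x).symm
              · exact (congrFun (congrArg Hom.onState hw) x).symm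
            · exact (DFunLike.congr_fun (congrArg Hom.onPath hw) (f m)).symm } }
  have hf : f = fun m : M => Hom.onPath (hc.lift s) m := by
    funext m
    refine onPath_injective_of_isLimit hc fun j => ?_
    exact (DFunLike.congr_fun (congrArg Hom.onPath (hc.fac s j)) m).symm
  rw [hf]
  exact (Hom.onPath (hc.lift s)).continuous

/-- A family of morphisms to a finite limit is continuous if its projections to the objects of the
diagram are. -/
theorem continuous_of_isLimit [Finite J] {Z : Type u} [TopologicalSpace Z]
    [CompactlyGeneratedSpace Z] {X : DirFlow.{u}} (φ : Z → FLOW X c.pt)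
    (h : ∀ j, Continuous fun z => FLOW.map (𝟙 X) (c.π.app j) (φ z)) : Continuous φ := by
  refine continuous_from_compactlyGeneratedSpace _ fun K _ _ _ g hg => ?_
  have hg (j : J) := FLOW.continuous_iff.1 ((h j).comp hg)
  refine FLOW.continuous_iff.2 ⟨fun x => continuous_state_of_isLimit hc fun j => (hg j).1 x, ?_⟩
  refine continuous_prod_of_compactlyGeneratedSpace fun L _ _ _ l hl => ?_
  exact continuous_path_of_isLimit hc fun j => (hg j).2.comp (continuous_id.prodMap hl)

end Limits

/-! ### The universal properties in `CGWH`. -/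

section Functor

variable (hobj : FLOWIsCGWH.{u}) (hmap : FLOWMapContinuous.{u})

/-- Each point of the apex of a cone of spaces is a cocone of flows with apex `Y`, which `hc`
factors uniquely. The resulting map is continuous because the apex is a `k`-space. -/
theorem isLimit_mapCone_of_isColimit {J : Type w} [Category.{v} J] {D : J ⥤ DirFlow.{u}}
    {c : Cocone D} (hc : IsColimit c) (Y : DirFlow.{u}) :
    Nonempty (IsLimit ((Prod.sectL DirFlow.{u}ᵒᵖ Y ⋙ flowFunctor hobj hmap).mapCone c.op)) := by
  let t (s : Cone (D.op ⋙ Prod.sectL DirFlow.{u}ᵒᵖ Y ⋙ flowFunctor hobj hmap))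
      (z : s.pt.obj) : Cocone D :=
    { pt := Y
      ι :=
        { app j := (s.π.app (op j)).hom.hom z
          naturality i j f := by
            exact congrArg (fun a => a.hom.hom z) (s.w f.op) } }
  let φ (s) (z) : FLOW c.pt Y := hc.desc (t s z)
  have hφ (s) (j : J) (z) : FLOW.map (c.ι.app j) (𝟙 Y) (φ s z) = (s.π.app (op j)).hom.hom z :=
    hc.fac (t s z) j
  have hcont (s) : Continuous (φ s) := by
    have : CompactlyGeneratedSpace s.pt.obj := s.pt.property.1
    refine continuous_of_isColimit hc _ fun j => ?_
    simp only [hφ]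
    exact (s.π.app (op j)).hom.hom.continuous
  refine ⟨{ lift s := ObjectProperty.homMk (TopCat.ofHom ⟨φ s, hcont s⟩)
            fac s j := ?_
            uniq s m hm := ?_ }⟩
  · ext z
    exact hφ s j.unop z
  · ext z
    refine hc.hom_ext fun j => ?_
    refine Eq.trans ?_ (hφ s j z).symm
    exact congrArg (fun a => a.hom.hom z) (hm (op j))

theorem isLimit_mapCone_of_isLimit {J : Type w} [Category.{v} J] [Finite J]
    {D : J ⥤ DirFlow.{u}} {c : Cone D} (hc : IsLimit c) (X : DirFlow.{u}) :
    Nonempty (IsLimit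
      ((Prod.sectR (op X) DirFlow.{u} ⋙ flowFunctor hobj hmap).mapCone c)) := by
  let t (s : Cone (D ⋙ Prod.sectR (op X) DirFlow.{u} ⋙ flowFunctor hobj hmap))
      (z : s.pt.obj) : Cone D :=
    { pt := X
      π :=
        { app j := (s.π.app j).hom.hom z
          naturality i j f := by
            exact (congrArg (fun a => a.hom.hom z) (s.w f)).symm } }
  let φ (s) (z) : FLOW X c.pt := hc.lift (t s z)
  have hφ (s) (j : J) (z) : FLOW.map (𝟙 X) (c.π.app j) (φ s z) = (s.π.app j).hom.hom z :=
    hc.fac (t s z) j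
  have hcont (s) : Continuous (φ s) := by
    have : CompactlyGeneratedSpace s.pt.obj := s.pt.property.1
    refine continuous_of_isLimit hc _ fun j => ?_
    simp only [hφ]
    exact (s.π.app j).hom.hom.continuous
  refine ⟨{ lift s := ObjectProperty.homMk (TopCat.ofHom ⟨φ s, hcont s⟩)
            fac s j := ?_
            uniq s m hm := ?_ }⟩
  · ext z
    exact hφ s j z
  · ext z
    refine hc.hom_ext fun j => ?_
    refine Eq.trans ?_ (hφ s j z).symm
    exact congrArg (fun a => a.hom.hom z) (hm j)

end Functor

end DirFlow

/-- The spaces `FLOW X Y` are weak Hausdorff `k`-spaces, composition with morphisms of flows makes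
them a functor of `(X, Y)`, every functor `FLOW(-, Y)` turns colimit cocones into limit cones, and
every functor `FLOW(X, -)` preserves finite limit cones. -/
theorem mainTheorem3 :
    ∃ (hobj : DirFlow.FLOWIsCGWH.{u}) (hmap : DirFlow.FLOWMapContinuous.{u}),
      (∀ (J : Type w) [Category.{v} J] (D : J ⥤ DirFlow.{u}) (c : Cocone D), IsColimit c →
        ∀ Y : DirFlow.{u}, Nonempty (IsLimit
          ((Prod.sectL DirFlow.{u}ᵒᵖ Y ⋙ DirFlow.flowFunctor hobj hmap).mapCone c.op))) ∧
      (∀ (J : Type w) [SmallCategory J] [FinCategory J] (D : J ⥤ DirFlow.{u}) (c : Cone D), IsLimit c →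
        ∀ X : DirFlow.{u}, Nonempty (IsLimit
          ((Prod.sectR (op X) DirFlow.{u} ⋙ DirFlow.flowFunctor hobj hmap).mapCone c))) :=
  ⟨DirFlow.FLOWIsCGWH.of_all, DirFlow.FLOWMapContinuous.of_all,
    fun _ _ _ _ hc Y => DirFlow.isLimit_mapCone_of_isColimit _ _ hc Y,
    fun _ _ _ _ _ hc X => DirFlow.isLimit_mapCone_of_isLimit _ _ hc X⟩
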